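/- Let $p$ be an odd prime and $X=\mathbb{Z}_p\times\mathbb{Z}/(p-1)\mathbb{Z}$. Let $\omega$ be the Teichmüller character modulo $p$, with values in $\mathbb{Z}_p\subset\mathbb{C}_p$; a Dirichlet character $\chi$ modulo $p^v$ ($v\ge 1$) is extended to $\mathbb{Z}_p$ by continuity (so $\omega^0$ is the trivial character modulo $p$, which vanishes on $p\mathbb{Z}_p$). For $0\neq a\in\mathbb{Z}_p$ with $a=p^{r}a'$ and $a'\in\mathbb{Z}_p^\times$, put $\langle a\rangle=a'/\omega(a')$, and $\langle a\rangle^{z}=\sum_{n\ge0}\binom{z}{n}(\langle a\rangle-1)^n$. * Cohen's $p$-adic Hurwitz zeta function is, for $x\in\mathbb{Z}_p$, $z\in\mathbb{C}_p$, $|z|_p<p^{(p-2)/(p-1)}$, $z\ne1$, $$\zeta_p(z,\chi,x)=\frac1{z-1}\int_{\mathbb{Z}_p}\chi(x+a)\langle x+a\rangle^{1-z}\,da,\qquad \int_{\mathbb{Z}_p}f(a)\,da=\lim_{N\to\infty}\frac1{p^N}\sum_{a=0}^{p^N-1}f(a),$$ where $\chi(0)\langle 0\rangle^{1-z}$ is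 read as $0$; $\zeta_p(1,\chi,x)$ is the limit as $z\to1$ when this limit exists. The extended constant term is $a_0(z,\chi,x)=\tfrac12\zeta_p(1-z,\chi,x)$. * Iwasawa's $p$-adic $L$-function is $L_p(z,\chi)=\frac{1}{z-1}A_\chi(1-z)$ for $z\neq1$, where, with $\chi_n$ the primitive character attached to $\chi\omega^{-n}$ and $b_n=(1-\chi_n(p)p^{n-1})B_{n,\chi_n}$ ($B_{n,\chi_n}$ the generalized Bernoulli numbers), $A_\chi(t)=\sum_{n\ge0}c_n\binom tn$ and $c_n=\sum_{i=0}^n(-1)^{n-i}\binom ni b_i$, so that $A_\chi(n)=b_n$ for all $n\ge0$; $L_p(1,\chi)$ is the limit as $z\to1$ when this limit exists. * For $(s,u)\in X$ with $u$ even and $(s,u)\ne(0,0)$, Serre's $p$-adic Eisenstein series $G^*_{s,u}$ is the coefficientwise limit of the $q$-expansions $G_k=-\frac{B_k}{2k}+\sum_{n\ge1}\sigma_{k-1}(n)q^n$ as $k\to\infty$ through even positive integers with $k\to(s,u)$ in $X$, and $a_0(G^*_{s,u})$ is its constant term. **Proposition.** For every $(s,u)\in X$ with $u$ even and $(s,u)\neq(0,0)$,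 $$a_0(s,\omega^u,0)=\tfrac12\zeta_p(1-s,\omega^u,0)=a_0(G^*_{s,u})=\tfrac12L_p(1-s,\omega^u).$$ In particular the limit defining $a_0(G^*_{s,u})$ exists. For $s\neq0$, the binomial series $\langle a\rangle^{s}$ ($0\ne a\in\mathbb{Z}_p$), the integral defining $\zeta_p(1-s,\omega^u,0)$ and the series $A_{\omega^u}(s)$ converge. For $s=0$ (so $u\neq0$), the limits of $\zeta_p(z,\omega^u,0)$ and $L_p(z,\omega^u)$ as $z\to1$ in $\mathbb{C}_p$ exist. -/

import Mathlib

open Filter Topology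

noncomputable section

namespace PadicEisenstein

variable (p : ℕ) [Fact p.Prime]

/-! ### Characters and the projection `⟨·⟩` (for an odd prime `p`) -/

/-- The Teichmüller lift of `a` modulo `p`: `0` for `a = 0`, and otherwise the root of unity of
order prime to `p` in `ℤ_p` congruent to `a`. -/
def teichmullerLift : ZMod p →* ℤ_[p] :=
  ((WittVector.equiv p : WittVector p (ZMod p) ≃+* ℤ_[p]) :
    WittVector p (ZMod p) →* ℤ_[p]).comp (WittVector.teichmuller p)

theorem toZMod_teichmullerLift (a : ZMod p) : PadicInt.toZMod (teichmullerLift p a) = a := by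
  have key (f : ℤ_[p] →+* ZMod p) (x : ℤ_[p]) : f x = (x.zmodRepr : ZMod p) := by
    have hx := PadicInt.sub_zmodRepr_mem x
    rw [PadicInt.maximalIdeal_eq_span_p] at hx
    obtain ⟨y, hy⟩ := Ideal.mem_span_singleton.mp hx
    have h : f (x - x.zmodRepr) = f (p * y) := congrArg f hy
    rw [map_sub, map_mul, map_natCast, map_natCast, ZMod.natCast_self, zero_mul] at h
    exact sub_eq_zero.mp h
  have h := key ((WittVector.constantCoeff (p := p) (R := ZMod p)).comp
    ((WittVector.equiv p).symm : ℤ_[p] →+* WittVector p (ZMod p))) (teichmullerLift p a)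
  rw [key, ← h]
  simp [teichmullerLift]

theorem teichmullerLift_zero : teichmullerLift p 0 = 0 := by
  simp [teichmullerLift]

/-- The Teichmüller character `ω`, as a character modulo `p` with values in `ℂ_p`. -/
def teichmullerChar : DirichletCharacter ℂ_[p] p where
  toFun a := algebraMap ℚ_[p] ℂ_[p] (teichmullerLift p a : ℚ_[p])
  map_one' := by simp
  map_mul' a b := by simp
  map_nonunit' a ha := by
    have h : a = 0 := by
      by_contra h
      exact ha (isUnit_iff_ne_zero.mpr h)
    simp [h, teichmullerLift_zero]

/-- The Teichmüller character `ω`, regarded as a character modulo `p ^ (v + 1)`. -/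
def omega (v : ℕ) : DirichletCharacter ℂ_[p] (p ^ (v + 1)) :=
  DirichletCharacter.changeLevel (dvd_pow_self p (Nat.succ_ne_zero v)) (teichmullerChar p)

variable {p}

/-- The extension to `ℤ_p` of a Dirichlet character modulo a positive power of `p`. -/
def extendChar {v : ℕ} (χ : DirichletCharacter ℂ_[p] (p ^ (v + 1))) (a : ℤ_[p]) : ℂ_[p] :=
  χ (PadicInt.toZModPow (v + 1) a)

open Classical in
/-- `⟨a⟩ = p ^ (-v_p(a)) a / ω(p ^ (-v_p(a)) a)` for `a ≠ 0` in `ℤ_p`. The value at `a = 0`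
is a convention and is never used: it is always multiplied by `χ(0) = 0`. -/
def angle (a : ℤ_[p]) : ℚ_[p] :=
  if h : a = 0 then 1
  else ((PadicInt.unitCoeff h : ℤ_[p]) : ℚ_[p]) /
    (teichmullerLift p (PadicInt.toZMod (PadicInt.unitCoeff h : ℤ_[p])) : ℚ_[p])

/-- The terms of the binomial series `∑ binom(s, n) (⟨a⟩ - 1) ^ n`. -/
def anglePowTerm (a : ℤ_[p]) (s : ℂ_[p]) (n : ℕ) : ℂ_[p] :=
  Ring.choose s n * (algebraMap ℚ_[p] ℂ_[p] (angle a) - 1) ^ n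

/-- `⟨a⟩ ^ s` for `s ∈ ℂ_p`. -/
def anglePow (a : ℤ_[p]) (s : ℂ_[p]) : ℂ_[p] := ∑' n : ℕ, anglePowTerm a s n

/-! ### Volkenborn integral and Cohen's `p`-adic Hurwitz zeta function -/

/-- The sums `p ^ (-N) ∑_{0 ≤ a < p ^ N} f(a)`, whose limit is the Volkenborn integral. -/
def volkenbornSum (f : ℤ_[p] → ℂ_[p]) (N : ℕ) : ℂ_[p] :=
  ((p : ℂ_[p]) ^ N)⁻¹ * ∑ a ∈ Finset.range (p ^ N), f (a : ℤ_[p])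

/-- The Volkenborn integral `∫_{ℤ_p} f(a) da`. -/
def volkenbornIntegral (f : ℤ_[p] → ℂ_[p]) : ℂ_[p] := limUnder atTop (volkenbornSum f)

/-- A function on `ℂ_p \ {1}`, given a value at `1` by continuity. -/
def extendAtOne (f : ℂ_[p] → ℂ_[p]) : ℂ_[p] → ℂ_[p] :=
  letI := Classical.decEq ℂ_[p]
  Function.update f 1 (limUnder (𝓝[≠] 1) f)

theorem extendAtOne_of_ne (f : ℂ_[p] → ℂ_[p]) {z : ℂ_[p]} (h : z ≠ 1) :
    extendAtOne f z = f z := by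
  classical
  exact Function.update_of_ne h _ _

/-- The integrand `a ↦ χ(x + a) ⟨x + a⟩ ^ (1 - s)`. -/
def hurwitzIntegrand {v : ℕ} (s : ℂ_[p]) (χ : DirichletCharacter ℂ_[p] (p ^ (v + 1)))
    (x a : ℤ_[p]) : ℂ_[p] :=
  extendChar χ (x + a) * anglePow (x + a) (1 - s)

/-- The `p`-adic Hurwitz zeta function
`ζ_p(s, χ, x) = (s - 1)⁻¹ ∫_{ℤ_p} χ(x + a) ⟨x + a⟩ ^ (1 - s) da`
(for `s = 1`: the limit, when there is one). -/
def hurwitzZeta {v : ℕ} (s : ℂ_[p]) (χ : DirichletCharacter ℂ_[p] (p ^ (v + 1)))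
    (x : ℤ_[p]) : ℂ_[p] :=
  extendAtOne (fun z ↦ (z - 1)⁻¹ * volkenbornIntegral (hurwitzIntegrand z χ x)) s

/-- The extended constant term `a_0(s, χ, x) = ½ ζ_p(1 - s, χ, x)`. -/
def constantTerm {v : ℕ} (s : ℂ_[p]) (χ : DirichletCharacter ℂ_[p] (p ^ (v + 1)))
    (x : ℤ_[p]) : ℂ_[p] :=
  1 / 2 * hurwitzZeta (1 - s) χ x

/-! ### Iwasawa's `p`-adic `L`-function, by `p`-adic interpolation -/

/-- The generalized Bernoulli number
`B_{n, χ} = f ^ (n - 1) ∑_{a = 1}^{f} χ(a) B_n(a / f)` for a character `χ` modulo `f`. -/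
def generalizedBernoulli {f : ℕ} (χ : DirichletCharacter ℂ_[p] f) (n : ℕ) : ℂ_[p] :=
  (f : ℂ_[p]) ^ ((n : ℤ) - 1) *
    ∑ a ∈ Finset.Icc 1 f,
      χ (a : ZMod f) * Polynomial.aeval ((a : ℂ_[p]) / (f : ℂ_[p])) (Polynomial.bernoulli n)

/-- `b_n = (1 - χ_n(p) p ^ (n - 1)) B_{n, χ_n}`, where `χ_n` is the primitive character
attached to `χ ω ^ (-n)`. -/
def interpolationValue {v : ℕ} (χ : DirichletCharacter ℂ_[p] (p ^ (v + 1))) (n : ℕ) : ℂ_[p] :=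
  let ψ := (χ * (omega p v ^ n)⁻¹).primitiveCharacter
  (1 - ψ (p : ZMod _) * (p : ℂ_[p]) ^ ((n : ℤ) - 1)) * generalizedBernoulli ψ n

/-- The terms `c_n binom(t, n)`, `c_n = ∑_i (-1) ^ (n - i) binom(n, i) b_i`, of the series
interpolating the numbers `b_n`. -/
def interpolationTerm {v : ℕ} (χ : DirichletCharacter ℂ_[p] (p ^ (v + 1))) (t : ℂ_[p]) (n : ℕ) :
    ℂ_[p] :=
  (fwdDiff 1)^[n] (interpolationValue χ) 0 * Ring.choose t n

/-- The `p`-adic `L`-function `L_p(s, χ) = (s - 1)⁻¹ A_χ(1 - s)`, where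
`A_χ(t) = ∑ c_n binom(t, n)` is the function with `A_χ(n) = b_n` for all `n ≥ 0`
(for `s = 1`: the limit, when there is one). -/
def padicL {v : ℕ} (s : ℂ_[p]) (χ : DirichletCharacter ℂ_[p] (p ^ (v + 1))) : ℂ_[p] :=
  extendAtOne (fun z ↦ (z - 1)⁻¹ * ∑' n : ℕ, interpolationTerm χ (1 - z) n) s

theorem tsum_interpolationTerm_natCast {v : ℕ} (χ : DirichletCharacter ℂ_[p] (p ^ (v + 1)))
    (n : ℕ) : ∑' k : ℕ, interpolationTerm χ (n : ℂ_[p]) k = interpolationValue χ n := by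
  rw [tsum_eq_sum (s := Finset.range (n + 1))]
  · have h := shift_eq_sum_fwdDiff_iter (1 : ℕ) (interpolationValue χ) n 0
    simp only [smul_eq_mul, mul_one, zero_add] at h
    rw [h]
    refine Finset.sum_congr rfl fun k _ ↦ ?_
    rw [interpolationTerm, Ring.choose_natCast, nsmul_eq_mul, mul_comm]
  · intro k hk
    rw [interpolationTerm, Ring.choose_natCast,
      Nat.choose_eq_zero_of_lt (by simpa [Nat.lt_succ_iff] using hk)]
    simp

/-- The interpolation property `L_p(1 - n, χ) = -(1 - χ_n(p) p ^ (n - 1)) B_{n, χ_n} / n`. -/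
theorem padicL_one_sub_natCast {v : ℕ} (χ : DirichletCharacter ℂ_[p] (p ^ (v + 1)))
    (n : ℕ) (hn : n ≠ 0) :
    padicL (1 - (n : ℂ_[p])) χ = -(interpolationValue χ n / n) := by
  have h : (1 - (n : ℂ_[p])) ≠ 1 := by simpa [sub_eq_self] using hn
  rw [padicL, extendAtOne_of_ne _ h, sub_sub_cancel,
    tsum_interpolationTerm_natCast, sub_sub_cancel_left, inv_neg, neg_mul, div_eq_inv_mul]

/-! ### The `p`-adic Eisenstein series -/

/-- The `q`-expansion `G_k = -B_k / (2 k) + ∑_{n ≥ 1} σ_{k-1}(n) q ^ n`. -/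
def eisensteinQExp (k : ℕ) : PowerSeries ℚ :=
  PowerSeries.mk fun n ↦
    if n = 0 then -bernoulli k / (2 * k) else (ArithmeticFunction.sigma (k - 1) n : ℚ)

/-- Even weights `k → ∞` converging to `(s, u)` in `X = ℤ_p × ℤ/(p-1)ℤ`. -/
def weightFilter (s : ℤ_[p]) (u : ZMod (p - 1)) : Filter ℕ :=
  atTop ⊓ comap (fun k : ℕ ↦ (k : ℤ_[p])) (𝓝 s) ⊓ 𝓟 {k : ℕ | Even k ∧ (k : ZMod (p - 1)) = u}

/-- The `p`-adic Eisenstein series `G*_{s,u}`, the limit of the `q`-expansions `G_k` over even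
`k → ∞` with `k → (s, u)` in `X`. -/
def padicEisenstein (s : ℤ_[p]) (u : ZMod (p - 1)) : PowerSeries ℚ_[p] :=
  PowerSeries.mk fun n ↦
    limUnder (weightFilter s u) fun k ↦ ((PowerSeries.coeff n (eisensteinQExp k) : ℚ) : ℚ_[p])

end PadicEisenstein

end

/-!
On units `a = ω(a) ⟨a⟩`, so `χ(a) ⟨a⟩ ^ m = (χ ω ^ (-m))(a) a ^ m`, and a sum of powers over
`[0, p ^ N)` is a difference of values of a Bernoulli polynomial. Hence
`∫ χ(a) ⟨a⟩ ^ m da = (1 - χ_m(p) p ^ (m - 1)) B_{m, χ_m} = b_m`, and by taking `n`-th differences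
in `m`, `∫ χ(a) (⟨a⟩ - 1) ^ n da = c_n`. Since `⟨a⟩ ≡ 1` modulo `p`, these integrals are
`O(p ^ (-n))` in absolute value, which beats `n!` for odd `p`: expanding `⟨a⟩ ^ t` in a binomial
series and integrating term by term gives `∫ χ(a) ⟨a⟩ ^ t da = ∑ c_n binom(t, n) = A_χ(t)` for
`|t| ≤ 1`, that is, `ζ_p(z, χ, 0) = L_p(z, χ)`. For `χ ≠ 1` this function is also continuous at `1`,
as `A_χ(0) = b_0 = 0` and `A_χ` is differentiable at `0`. At a weight `k ≡ u` modulo `p - 1` the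
interpolation property says `½ L_p(1 - k, ω ^ u) = (1 - p ^ (k - 1)) a_0(G_k)`; now let
`k → (s, u)`.
-/

noncomputable section

namespace PadicEisenstein

/-! ### Binomial series over an ultrametric field -/

section NewtonSeries

variable {K : Type*} [NormedField K]

theorem norm_sub_one_le_one [IsUltrametricDist K] {t : K} (ht : ‖t‖ ≤ 1) : ‖t - 1‖ ≤ 1 := by
  simpa [sub_eq_add_neg, ht] using IsUltrametricDist.norm_add_le_max t (-1)

variable [CharZero K]

theorem choose_succ_eq_mul_choose_sub_one_div (t : K) (n : ℕ) :
    Ring.choose t (n + 1) = t * (Ring.choose (t - 1) n / (n + 1)) := by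
  have h := Ring.choose_smul_choose t (Nat.le_add_left 1 n)
  rw [Nat.choose_one_right, nsmul_eq_mul, Ring.choose_one_right, Nat.cast_one,
    Nat.add_sub_cancel] at h
  rw [← mul_div_assoc, ← h, Nat.cast_succ, mul_div_cancel_left₀ _ n.cast_add_one_ne_zero]

theorem continuous_choose (n : ℕ) : Continuous fun t : K ↦ Ring.choose t n := by
  induction n with
  | zero => simpa only [Ring.choose_zero_right] using continuous_const
  | succ n ih =>
    simp only [choose_succ_eq_mul_choose_sub_one_div]
    exact continuous_id.mul ((ih.comp (continuous_id.sub continuous_const)).div_const _)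

/-- The Newton series `∑ cₙ binom(t, n)`, the Mahler expansion with coefficients `cₙ`. -/
def newtonSeries (c : ℕ → K) (t : K) : K := ∑' n, c n * Ring.choose t n

variable [IsUltrametricDist K] {t : K}

theorem norm_choose_le (ht : ‖t‖ ≤ 1) (n : ℕ) : ‖Ring.choose t n‖ ≤ ‖(n.factorial : K)‖⁻¹ := by
  induction n generalizing t with
  | zero => simp
  | succ n ih =>
    rw [choose_succ_eq_mul_choose_sub_one_div, Nat.factorial_succ, Nat.cast_mul, norm_mul,
      norm_div, norm_mul, mul_inv_rev, Nat.cast_succ, div_eq_mul_inv]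
    refine (mul_le_of_le_one_left (by positivity) ht).trans ?_
    gcongr
    exact ih (norm_sub_one_le_one ht)

theorem norm_choose_sub_one_div_le (ht : ‖t‖ ≤ 1) (n : ℕ) :
    ‖Ring.choose (t - 1) n / (n + 1)‖ ≤ ‖((n + 1).factorial : K)‖⁻¹ := by
  rw [Nat.factorial_succ, Nat.cast_mul, norm_mul, mul_inv_rev, Nat.cast_succ, norm_div,
    div_eq_mul_inv]
  gcongr
  exact norm_choose_le (norm_sub_one_le_one ht) n

theorem norm_mul_choose_le (a : K) (ht : ‖t‖ ≤ 1) (n : ℕ) :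
    ‖a * Ring.choose t n‖ ≤ ‖a‖ / ‖(n.factorial : K)‖ := by
  rw [norm_mul, div_eq_mul_inv]
  gcongr
  exact norm_choose_le ht n

variable [CompleteSpace K] {c : ℕ → K}

theorem continuousOn_newtonSeries (hc : Summable fun n ↦ ‖c n‖ / ‖(n.factorial : K)‖) :
    ContinuousOn (newtonSeries c) (Metric.closedBall 0 1) :=
  continuousOn_tsum (fun n ↦ ((continuous_choose n).const_mul (c n)).continuousOn) hc fun n _ ht ↦
    norm_mul_choose_le _ (mem_closedBall_zero_iff.mp ht) n

theorem summable_mul_choose (hc : Summable fun n ↦ ‖c n‖ / ‖(n.factorial : K)‖) (ht : ‖t‖ ≤ 1) :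
    Summable fun n ↦ c n * Ring.choose t n :=
  hc.of_norm_bounded fun n ↦ norm_mul_choose_le _ ht n

theorem newtonSeries_eq_add_mul (hc : Summable fun n ↦ ‖c n‖ / ‖(n.factorial : K)‖)
    (ht : ‖t‖ ≤ 1) :
    newtonSeries c t = c 0 + t * ∑' n : ℕ, c (n + 1) * (Ring.choose (t - 1) n / (n + 1)) := by
  rw [newtonSeries, (summable_mul_choose hc ht).tsum_eq_zero_add, Ring.choose_zero_right, mul_one,
    ← tsum_mul_left]
  simp only [choose_succ_eq_mul_choose_sub_one_div t, mul_left_comm t]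

end NewtonSeries

theorem differentiableAt_newtonSeries_zero {K : Type*} [NontriviallyNormedField K] [CharZero K]
    [IsUltrametricDist K] [CompleteSpace K] {c : ℕ → K}
    (hc : Summable fun n ↦ ‖c n‖ / ‖(n.factorial : K)‖) :
    DifferentiableAt K (newtonSeries c) 0 := by
  set slopeSeries : K → K := fun t ↦ ∑' n : ℕ, c (n + 1) * (Ring.choose (t - 1) n / (n + 1))
  have hcont : ContinuousOn slopeSeries (Metric.closedBall 0 1) := by
    refine continuousOn_tsum (fun n ↦ ?_) ((summable_nat_add_iff 1).mpr hc) fun n t ht ↦ ?_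
    · exact ((((continuous_choose n).comp (continuous_id.sub continuous_const)).div_const
        _).const_mul _).continuousOn
    · simp only [norm_mul, div_eq_mul_inv ‖c _‖]
      gcongr
      exact norm_choose_sub_one_div_le (mem_closedBall_zero_iff.mp ht) n
  have hball : Metric.closedBall (0 : K) 1 ∈ 𝓝 0 := Metric.closedBall_mem_nhds _ one_pos
  have hdiff : HasDerivAt (fun t ↦ c 0 + t * slopeSeries t) (slopeSeries 0) 0 := by
    refine hasDerivAt_iff_tendsto_slope.mpr
      (((hcont.continuousAt hball).tendsto.mono_left nhdsWithin_le_nhds).congr' ?_)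
    filter_upwards [self_mem_nhdsWithin] with t ht
    simp [slope_def_field, mul_div_cancel_left₀ _ (show t ≠ 0 from ht)]
  refine (hdiff.congr_of_eventuallyEq ?_).differentiableAt
  filter_upwards [hball] with t ht
  exact newtonSeries_eq_add_mul hc (mem_closedBall_zero_iff.mp ht)

variable {p : ℕ} [hp : Fact p.Prime]

/-! ### Sums over `[0, p ^ N)` of Lipschitz functions -/

theorem norm_natCast_padicComplex (n : ℕ) : ‖(n : ℂ_[p])‖ = ‖(n : ℚ_[p])‖ := by
  rw [← map_natCast (algebraMap ℚ_[p] ℂ_[p]), norm_algebraMap']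

theorem norm_prime : ‖(p : ℂ_[p])‖ = (p : ℝ)⁻¹ := by
  rw [norm_natCast_padicComplex, Padic.norm_p]

theorem inv_prime_lt_one : (p : ℝ)⁻¹ < 1 :=
  inv_lt_one_of_one_lt₀ (Nat.one_lt_cast.mpr hp.out.one_lt)

theorem tendsto_prime_pow : Tendsto (fun N : ℕ ↦ (p : ℂ_[p]) ^ N) atTop (𝓝 0) :=
  tendsto_pow_atTop_nhds_zero_of_norm_lt_one (norm_prime.trans_lt inv_prime_lt_one)

theorem inv_pow_le_norm_factorial_sq (hp2 : p ≠ 2) (n : ℕ) :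
    (p : ℝ)⁻¹ ^ n ≤ ‖(n.factorial : ℂ_[p])‖ ^ 2 := by
  have two_le_pred : 2 ≤ p - 1 := Nat.le_sub_one_of_lt (hp.out.two_le.lt_of_ne' hp2)
  rw [norm_natCast_padicComplex, Padic.norm_eq_zpow_neg_valuation (by simp [Nat.factorial_ne_zero]),
    Padic.valuation_natCast, zpow_neg, zpow_natCast, ← inv_pow, ← pow_mul]
  refine pow_le_pow_of_le_one (by positivity) inv_prime_lt_one.le ?_
  calc padicValNat p n.factorial * 2
      ≤ padicValNat p n.factorial * (p - 1) := Nat.mul_le_mul_left _ two_le_pred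
    _ = n - (p.digits n).sum := by rw [mul_comm, sub_one_mul_padicValNat_factorial]
    _ ≤ n := Nat.sub_le _ _

theorem summable_inv_pow_div_norm_factorial (hp2 : p ≠ 2) :
    Summable fun n : ℕ ↦ (p : ℝ)⁻¹ ^ n / ‖(n.factorial : ℂ_[p])‖ := by
  set r := √(p : ℝ)⁻¹
  have r_sq : r ^ 2 = (p : ℝ)⁻¹ := Real.sq_sqrt (by positivity)
  have r_lt_one : r < 1 := (Real.sqrt_lt' one_pos).mpr (by simpa using inv_prime_lt_one)
  refine (summable_geometric_of_lt_one (Real.sqrt_nonneg _) r_lt_one).of_nonneg_of_le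
    (fun n ↦ by positivity) fun n ↦ ?_
  have hr : r ^ n ≤ ‖(n.factorial : ℂ_[p])‖ := by
    refine le_of_sq_le_sq ?_ (norm_nonneg _)
    rw [pow_right_comm, r_sq]
    exact inv_pow_le_norm_factorial_sq hp2 n
  have r_pow_sq : (p : ℝ)⁻¹ ^ n = r ^ n * r ^ n := by rw [← r_sq, pow_right_comm, sq]
  rw [div_le_iff₀ (norm_pos_iff.mpr (Nat.cast_ne_zero.mpr n.factorial_ne_zero)), r_pow_sq]
  gcongr

theorem summable_norm_div_norm_factorial (hp2 : p ≠ 2) {c : ℕ → ℂ_[p]} {C : ℝ}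
    (hc : ∀ n, ‖c n‖ ≤ C * (p : ℝ)⁻¹ ^ n) :
    Summable fun n ↦ ‖c n‖ / ‖(n.factorial : ℂ_[p])‖ := by
  refine ((summable_inv_pow_div_norm_factorial hp2).mul_left C).of_nonneg_of_le
    (fun n ↦ by positivity) fun n ↦ ?_
  rw [← mul_div_assoc]
  gcongr
  exact hc n

theorem sum_range_mul {M : Type*} [AddCommMonoid M] (m n : ℕ) (f : ℕ → M) :
    ∑ a ∈ Finset.range (m * n), f a =
      ∑ b ∈ Finset.range n, ∑ r ∈ Finset.range m, f (r + m * b) := by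
  induction n with
  | zero => simp
  | succ n ih =>
    rw [mul_add_one, Finset.sum_range_add, ih, Finset.sum_range_succ]
    simp only [add_comm]

theorem norm_volkenbornSum_succ_sub_le {f : ℤ_[p] → ℂ_[p]} {C : NNReal} (hf : LipschitzWith C f)
    (N : ℕ) : ‖volkenbornSum f (N + 1) - volkenbornSum f N‖ ≤ p * C := by
  have hp0 : (p : ℂ_[p]) ≠ 0 := Nat.cast_ne_zero.mpr hp.out.ne_zero
  have hsum : volkenbornSum f (N + 1) - volkenbornSum f N =
      ((p : ℂ_[p]) ^ (N + 1))⁻¹ * ∑ b ∈ Finset.range p, ∑ r ∈ Finset.range (p ^ N),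
        (f ((r + p ^ N * b : ℕ) : ℤ_[p]) - f (r : ℤ_[p])) := by
    simp only [Finset.sum_sub_distrib, Finset.sum_const, Finset.card_range, nsmul_eq_mul,
      volkenbornSum, pow_succ p N, sum_range_mul, mul_sub]
    congr 1
    rw [pow_succ, mul_inv, mul_assoc, inv_mul_cancel_left₀ hp0]
  rw [hsum, norm_mul, norm_inv, norm_pow, norm_prime, inv_pow, inv_inv, pow_succ']
  have hterm : ‖∑ b ∈ Finset.range p, ∑ r ∈ Finset.range (p ^ N),
      (f ((r + p ^ N * b : ℕ) : ℤ_[p]) - f (r : ℤ_[p]))‖ ≤ C * ((p : ℝ) ^ N)⁻¹ := by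
    refine IsUltrametricDist.norm_sum_le_of_forall_le_of_nonneg (by positivity) fun b _ ↦
      IsUltrametricDist.norm_sum_le_of_forall_le_of_nonneg (by positivity) fun r _ ↦ ?_
    rw [← dist_eq_norm]
    refine (hf.dist_le_mul _ _).trans ?_
    gcongr
    rw [dist_eq_norm, Nat.cast_add, add_sub_cancel_left, Nat.cast_mul, norm_mul, Nat.cast_pow,
      norm_pow, PadicInt.norm_p, inv_pow]
    exact mul_le_of_le_one_right (by positivity) (PadicInt.norm_le_one _)
  calc (p : ℝ) * p ^ N * _ ≤ p * p ^ N * (C * ((p : ℝ) ^ N)⁻¹) := by gcongr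
    _ = p * C := by
      have : (p : ℝ) ^ N ≠ 0 := pow_ne_zero _ (Nat.cast_ne_zero.mpr hp.out.ne_zero)
      field_simp

theorem norm_volkenbornSum_le {f : ℤ_[p] → ℂ_[p]} {C : NNReal} (hf : LipschitzWith C f) (N : ℕ) :
    ‖volkenbornSum f N‖ ≤ max ‖f 0‖ (p * C) := by
  induction N with
  | zero => simp [volkenbornSum]
  | succ N ih =>
    rw [← sub_add_cancel (volkenbornSum f (N + 1)) (volkenbornSum f N)]
    refine (IsUltrametricDist.norm_add_le_max _ _).trans (max_le ?_ ih)
    exact (norm_volkenbornSum_succ_sub_le hf N).trans (le_max_right _ _)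

/-! ### Power sums and Bernoulli polynomials -/

section PowerSums

variable {K : Type*} [NontriviallyNormedField K] [CharZero K]

theorem aeval_bernoulli_one_add (m : ℕ) (x : K) :
    Polynomial.aeval (1 + x) (Polynomial.bernoulli (m + 1)) =
      Polynomial.aeval x (Polynomial.bernoulli (m + 1)) + (m + 1) * x ^ m := by
  simpa [Polynomial.aeval_comp] using
    congrArg (Polynomial.aeval x) (Polynomial.bernoulli_comp_one_add_X (m + 1))

theorem add_one_mul_sum_add_pow (x : K) (m M : ℕ) :
    ((m : K) + 1) * ∑ b ∈ Finset.range M, (x + b) ^ m =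
      Polynomial.aeval (x + M) (Polynomial.bernoulli (m + 1)) -
        Polynomial.aeval x (Polynomial.bernoulli (m + 1)) := by
  induction M with
  | zero => simp
  | succ M ih =>
    rw [Finset.sum_range_succ, mul_add, ih, Nat.cast_succ, add_comm (M : K) 1, add_left_comm,
      aeval_bernoulli_one_add]
    ring

variable {ι : Type*} {l : Filter ι} {M : ι → ℕ}

/- `(m + 1) ∑_{b < M} (x + b) ^ m` is the difference `B_{m+1}(x + M) - B_{m+1}(x)`, so the limit is
the derivative of `B_{m+1} / (m + 1)` at `x`. -/
theorem tendsto_inv_mul_sum_add_pow (hM : Tendsto (fun i ↦ (M i : K)) l (𝓝[≠] 0)) (x : K) (m : ℕ) :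
    Tendsto (fun i ↦ (M i : K)⁻¹ * ∑ b ∈ Finset.range (M i), (x + b) ^ m) l
      (𝓝 (Polynomial.aeval x (Polynomial.bernoulli m))) := by
  have hm : (m : K) + 1 ≠ 0 := m.cast_add_one_ne_zero
  have hderiv := (Polynomial.bernoulli (m + 1)).hasDerivAt_aeval x
  have hslope := ((hasDerivAt_iff_tendsto_slope_zero.mp hderiv).comp hM).const_mul ((m : K) + 1)⁻¹
  simp only [Polynomial.derivative_bernoulli_add_one, map_mul, map_add, map_natCast, map_one,
    inv_mul_cancel_left₀ hm] at hslope
  refine hslope.congr fun i ↦ ?_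
  rw [Function.comp_apply, ← add_one_mul_sum_add_pow, smul_eq_mul, mul_left_comm,
    inv_mul_cancel_left₀ hm]

end PowerSums

theorem sum_Icc_one_eq_sum_range {M : Type*} [AddCommMonoid M] (n : ℕ) (g : ℕ → M) :
    ∑ a ∈ Finset.Icc 1 n, g a = ∑ a ∈ Finset.range n, g (a + 1) := by
  rw [Finset.range_eq_Ico, Finset.sum_Ico_add']
  rfl

theorem sum_Icc_ite_dvd {M : Type*} [AddCommMonoid M] {d : ℕ} (hd : 0 < d) (n : ℕ) (g : ℕ → M) :
    (∑ a ∈ Finset.Icc 1 (d * n), if d ∣ a then g a else 0) =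
      ∑ b ∈ Finset.Icc 1 n, g (d * b) := by
  rw [← Finset.sum_filter]
  refine (Finset.sum_nbij (d * ·) (fun b hb ↦ ?_) (fun b _ c _ h ↦ Nat.eq_of_mul_eq_mul_left hd h)
    (fun a ha ↦ ?_) fun _ _ ↦ rfl).symm
  · obtain ⟨one_le, le⟩ := Finset.mem_Icc.mp hb
    simp [Nat.mul_le_mul_left d le, Nat.one_le_iff_ne_zero, hd.ne', Nat.ne_of_gt one_le]
  · obtain ⟨ha, b, rfl⟩ := Finset.mem_filter.mp ha
    obtain ⟨one_le, le⟩ := Finset.mem_Icc.mp ha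
    exact ⟨b, by simpa using ⟨Nat.pos_of_mul_pos_left one_le, Nat.le_of_mul_le_mul_left le hd⟩, rfl⟩

/-- The sum `∑_{1 ≤ a ≤ M} ψ(a) a ^ m`, whose quotients by `M = f p ^ N` tend to `B_{m, ψ}` as
`N → ∞`. The range starts at `1` because `B_{m, ψ}` is defined by a sum over `1 ≤ a ≤ f`. -/
def charPowerSum {f : ℕ} (ψ : DirichletCharacter ℂ_[p] f) (m M : ℕ) : ℂ_[p] :=
  ∑ a ∈ Finset.Icc 1 M, ψ a * (a : ℂ_[p]) ^ m

theorem charPowerSum_mul {f : ℕ} [NeZero f] (ψ : DirichletCharacter ℂ_[p] f) (m M : ℕ) :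
    charPowerSum ψ m (f * M) =
      f ^ m * ∑ a ∈ Finset.Icc 1 f, ψ a * ∑ b ∈ Finset.range M, ((a : ℂ_[p]) / f + b) ^ m := by
  have hf : (f : ℂ_[p]) ≠ 0 := NeZero.ne _
  simp only [charPowerSum, sum_Icc_one_eq_sum_range, sum_range_mul, Finset.mul_sum]
  rw [Finset.sum_comm]
  refine Finset.sum_congr rfl fun r _ ↦ Finset.sum_congr rfl fun b _ ↦ ?_
  rw [mul_left_comm, ← mul_pow, mul_add, mul_div_cancel₀ _ hf]
  push_cast [add_right_comm]
  simp

theorem tendsto_charPowerSum_mul {f : ℕ} [NeZero f] (ψ : DirichletCharacter ℂ_[p] f) (m : ℕ)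
    {ι : Type*} {l : Filter ι} {M : ι → ℕ} (hM : Tendsto (fun i ↦ (M i : ℂ_[p])) l (𝓝[≠] 0)) :
    Tendsto (fun i ↦ ((f * M i : ℕ) : ℂ_[p])⁻¹ * charPowerSum ψ m (f * M i)) l
      (𝓝 (generalizedBernoulli ψ m)) := by
  have hf : (f : ℂ_[p]) ≠ 0 := NeZero.ne _
  have hlim := (tendsto_finsetSum (Finset.Icc 1 f) fun a _ ↦
    (tendsto_inv_mul_sum_add_pow hM ((a : ℂ_[p]) / f) m).const_mul (ψ a)).const_mul
      ((f : ℂ_[p]) ^ ((m : ℤ) - 1))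
  refine hlim.congr fun i ↦ ?_
  rw [charPowerSum_mul, zpow_sub_one₀ hf, zpow_natCast, Nat.cast_mul, mul_inv]
  simp only [Finset.mul_sum]
  refine Finset.sum_congr rfl fun a _ ↦ Finset.sum_congr rfl fun b _ ↦ ?_
  ring

theorem tendsto_prime_pow_punctured :
    Tendsto (fun N : ℕ ↦ ((p ^ N : ℕ) : ℂ_[p])) atTop (𝓝[≠] 0) := by
  refine tendsto_nhdsWithin_iff.mpr ⟨?_, .of_forall fun N ↦
    Nat.cast_ne_zero.mpr (pow_ne_zero _ hp.out.ne_zero)⟩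
  simpa only [Nat.cast_pow] using tendsto_prime_pow

theorem tendsto_charPowerSum_prime_pow {f w : ℕ} (hf : f ∣ p ^ w)
    (ψ : DirichletCharacter ℂ_[p] f) (m : ℕ) :
    Tendsto (fun N : ℕ ↦ ((p : ℂ_[p]) ^ N)⁻¹ * charPowerSum ψ m (p ^ N)) atTop
      (𝓝 (generalizedBernoulli ψ m)) := by
  obtain ⟨e, -, rfl⟩ := (Nat.dvd_prime_pow hp.out).mp hf
  have : NeZero (p ^ e) := ⟨pow_ne_zero _ hp.out.ne_zero⟩
  rw [← tendsto_add_atTop_iff_nat e]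
  refine (tendsto_charPowerSum_mul ψ m tendsto_prime_pow_punctured).congr fun N ↦ ?_
  rw [add_comm N e, pow_add p, Nat.cast_mul, Nat.cast_pow, Nat.cast_pow, ← pow_add]

theorem changeLevel_prime_pow_apply {f v : ℕ} (hf : f ∣ p ^ (v + 1))
    (ψ : DirichletCharacter ℂ_[p] f) (a : ℕ) :
    DirichletCharacter.changeLevel hf ψ a = if p ∣ a then 0 else ψ a := by
  split_ifs with h
  · refine MulChar.map_nonunit _ fun ha ↦ ?_
    rw [ZMod.isUnit_iff_coprime, Nat.coprime_pow_right_iff v.succ_pos] at ha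
    exact (Nat.Prime.coprime_iff_not_dvd hp.out).mp ha.symm h
  · have ha : a.Coprime (p ^ (v + 1)) :=
      (((Nat.Prime.coprime_iff_not_dvd hp.out).mpr h).pow_left _).symm
    have := DirichletCharacter.changeLevel_eq_cast_of_dvd ψ hf (ZMod.unitOfCoprime a ha)
    rwa [ZMod.coe_unitOfCoprime, ZMod.cast_natCast hf] at this

theorem charPowerSum_changeLevel {f v : ℕ} (hf : f ∣ p ^ (v + 1))
    (ψ : DirichletCharacter ℂ_[p] f) (m M : ℕ) :
    charPowerSum (DirichletCharacter.changeLevel hf ψ) m (p * M) =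
      charPowerSum ψ m (p * M) - ψ p * p ^ m * charPowerSum ψ m M := by
  have hmul : ψ p * p ^ m * charPowerSum ψ m M =
      ∑ a ∈ Finset.Icc 1 (p * M), if p ∣ a then ψ a * (a : ℂ_[p]) ^ m else 0 := by
    rw [sum_Icc_ite_dvd hp.out.pos, charPowerSum, Finset.mul_sum]
    refine Finset.sum_congr rfl fun b _ ↦ ?_
    rw [Nat.cast_mul, Nat.cast_mul, map_mul, mul_pow]
    ring
  rw [hmul, charPowerSum, charPowerSum, ← Finset.sum_sub_distrib]
  refine Finset.sum_congr rfl fun a _ ↦ ?_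
  rw [changeLevel_prime_pow_apply]
  split_ifs <;> simp

theorem tendsto_charPowerSum_changeLevel {f v : ℕ} (hf : f ∣ p ^ (v + 1))
    (ψ : DirichletCharacter ℂ_[p] f) (m : ℕ) :
    Tendsto (fun N : ℕ ↦ ((p : ℂ_[p]) ^ N)⁻¹ *
        charPowerSum (DirichletCharacter.changeLevel hf ψ) m (p ^ N)) atTop
      (𝓝 ((1 - ψ p * (p : ℂ_[p]) ^ ((m : ℤ) - 1)) * generalizedBernoulli ψ m)) := by
  have hp0 : (p : ℂ_[p]) ≠ 0 := Nat.cast_ne_zero.mpr hp.out.ne_zero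
  have hlim := tendsto_charPowerSum_prime_pow hf ψ m
  rw [← tendsto_add_atTop_iff_nat 1, sub_mul, one_mul]
  refine (((tendsto_add_atTop_iff_nat 1).mpr hlim).sub (hlim.const_mul _)).congr fun N ↦ ?_
  rw [pow_succ' p, charPowerSum_changeLevel, zpow_sub_one₀ hp0, zpow_natCast, pow_succ', mul_inv]
  ring

theorem tendsto_charPowerSum_interpolationValue {v : ℕ}
    (χ : DirichletCharacter ℂ_[p] (p ^ (v + 1))) (m : ℕ) :
    Tendsto (fun N : ℕ ↦ ((p : ℂ_[p]) ^ N)⁻¹ * charPowerSum (χ * (omega p v ^ m)⁻¹) m (p ^ N))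
      atTop (𝓝 (interpolationValue χ m)) := by
  have := tendsto_charPowerSum_changeLevel
    (χ * (omega p v ^ m)⁻¹).conductor_dvd_level (χ * (omega p v ^ m)⁻¹).primitiveCharacter m
  rwa [DirichletCharacter.changeLevel_primitiveCharacter] at this

/-! ### The projection `⟨·⟩` and the integrals of its powers -/

instance nontrivial_zmod_prime_pow (v : ℕ) : Nontrivial (ZMod (p ^ (v + 1))) :=
  ZMod.nontrivial_iff.mpr (Nat.one_lt_pow v.succ_ne_zero hp.out.one_lt).ne'

theorem castHom_toZModPow (v : ℕ) (a : ℤ_[p]) :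
    ZMod.castHom (dvd_pow_self p v.succ_ne_zero) (ZMod p) (PadicInt.toZModPow (v + 1) a) =
      PadicInt.toZMod a := by
  have ker_eq (f : ℤ_[p] →+* ZMod p) : RingHom.ker f = IsLocalRing.maximalIdeal ℤ_[p] :=
    IsLocalRing.eq_maximalIdeal (RingHom.ker_isMaximal_of_surjective f (ZMod.ringHom_surjective f))
  exact DFunLike.congr_fun (ZMod.ringHom_eq_of_ker_eq
    ((ZMod.castHom (dvd_pow_self p v.succ_ne_zero) (ZMod p)).comp (PadicInt.toZModPow (v + 1)))
    PadicInt.toZMod ((ker_eq _).trans (ker_eq _).symm)) a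

theorem toZMod_ne_zero_iff_isUnit {a : ℤ_[p]} : PadicInt.toZMod a ≠ 0 ↔ IsUnit a := by
  rw [← isUnit_iff_ne_zero, isUnit_map_iff]

theorem norm_teichmullerLift {x : ZMod p} (hx : x ≠ 0) : ‖teichmullerLift p x‖ = 1 :=
  PadicInt.isUnit_iff.mp ((isUnit_iff_ne_zero.mpr hx).map (teichmullerLift p))

theorem norm_sub_teichmullerLift_le (a : ℤ_[p]) :
    ‖a - teichmullerLift p (PadicInt.toZMod a)‖ ≤ (p : ℝ)⁻¹ := by
  have hker : PadicInt.toZMod (a - teichmullerLift p (PadicInt.toZMod a)) = 0 := by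
    rw [map_sub, toZMod_teichmullerLift, sub_self]
  rw [← RingHom.mem_ker, PadicInt.ker_toZMod, PadicInt.maximalIdeal_eq_span_p,
    ← pow_one (p : ℤ_[p]), ← PadicInt.norm_le_pow_iff_mem_span_pow] at hker
  simpa using hker

theorem unitCoeff_of_isUnit {a : ℤ_[p]} (ha : IsUnit a) (h0 : a ≠ 0) :
    (PadicInt.unitCoeff h0 : ℤ_[p]) = a := by
  have hval : a.valuation = 0 := by
    have hnorm := PadicInt.isUnit_iff.mp ha
    rw [PadicInt.norm_eq_zpow_neg_valuation h0, zpow_eq_one_iff_right₀ (by positivity)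
      (Nat.one_lt_cast.mpr hp.out.one_lt).ne'] at hnorm
    omega
  simpa [hval] using (PadicInt.unitCoeff_spec h0).symm

theorem angle_of_isUnit {a : ℤ_[p]} (ha : IsUnit a) :
    angle a = a / teichmullerLift p (PadicInt.toZMod a) := by
  rw [angle, dif_neg ha.ne_zero, unitCoeff_of_isUnit ha]

theorem angle_unitCoeff {a : ℤ_[p]} (ha : a ≠ 0) : angle (PadicInt.unitCoeff ha) = angle a := by
  rw [angle_of_isUnit (Units.isUnit _), angle, dif_neg ha]

theorem norm_angle_sub_one_le (a : ℤ_[p]) : ‖angle a - 1‖ ≤ (p : ℝ)⁻¹ := by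
  rcases eq_or_ne a 0 with rfl | h0
  · simp [angle]
  have hunit : PadicInt.toZMod (PadicInt.unitCoeff h0 : ℤ_[p]) ≠ 0 :=
    toZMod_ne_zero_iff_isUnit.mpr (Units.isUnit _)
  have hnorm := norm_teichmullerLift hunit
  have hne : (teichmullerLift p (PadicInt.toZMod (PadicInt.unitCoeff h0 : ℤ_[p])) : ℚ_[p]) ≠ 0 := by
    rw [← norm_ne_zero_iff, PadicInt.padic_norm_e_of_padicInt, hnorm]
    exact one_ne_zero
  rw [← angle_unitCoeff h0, angle_of_isUnit (Units.isUnit _), div_sub_one hne, norm_div,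
    PadicInt.padic_norm_e_of_padicInt, hnorm, div_one, ← PadicInt.coe_sub,
    PadicInt.padic_norm_e_of_padicInt]
  exact norm_sub_teichmullerLift_le _

theorem norm_angle_sub_angle {a b : ℤ_[p]} (ha : IsUnit a)
    (hab : PadicInt.toZMod a = PadicInt.toZMod b) : ‖angle a - angle b‖ = ‖a - b‖ := by
  have ha' := toZMod_ne_zero_iff_isUnit.mpr ha
  have hb : IsUnit b := toZMod_ne_zero_iff_isUnit.mp (hab ▸ ha')
  rw [angle_of_isUnit ha, angle_of_isUnit hb, ← hab, ← sub_div, norm_div,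
    PadicInt.padic_norm_e_of_padicInt, norm_teichmullerLift ha', div_one, ← PadicInt.coe_sub,
    PadicInt.padic_norm_e_of_padicInt]

theorem omega_apply_toZModPow (v : ℕ) {a : ℤ_[p]} (ha : IsUnit a) :
    omega p v (PadicInt.toZModPow (v + 1) a) =
      algebraMap ℚ_[p] ℂ_[p] (teichmullerLift p (PadicInt.toZMod a)) := by
  rw [← castHom_toZModPow v]
  exact DirichletCharacter.changeLevel_eq_cast_of_dvd (teichmullerChar p) _
    (ha.map (PadicInt.toZModPow (v + 1))).unit

section Twist

variable {v : ℕ} (χ : DirichletCharacter ℂ_[p] (p ^ (v + 1)))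

theorem extendChar_eq_zero {a : ℤ_[p]} (ha : ¬IsUnit a) : extendChar χ a = 0 :=
  χ.map_nonunit ((isUnit_map_iff _ a).not.mpr ha)

theorem norm_extendChar_le_one (a : ℤ_[p]) : ‖extendChar χ a‖ ≤ 1 :=
  DirichletCharacter.norm_le_one χ _

/- On units `a = ω(a) ⟨a⟩`, so twisting by `ω ^ (-m)` turns `a ^ m` into `⟨a⟩ ^ m`. -/
theorem extendChar_mul_inv_omega_pow_mul_pow (m : ℕ) (a : ℤ_[p]) :
    extendChar (χ * (omega p v ^ m)⁻¹) a * algebraMap ℚ_[p] ℂ_[p] a ^ m =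
      extendChar χ a * algebraMap ℚ_[p] ℂ_[p] (angle a) ^ m := by
  by_cases ha : IsUnit a
  · have homega : (omega p v ^ m) (PadicInt.toZModPow (v + 1) a) =
        algebraMap ℚ_[p] ℂ_[p] (teichmullerLift p (PadicInt.toZMod a)) ^ m := by
      rw [← omega_apply_toZModPow v ha]
      exact MulChar.pow_apply_coe _ m (ha.map (PadicInt.toZModPow (v + 1))).unit
    rw [extendChar, extendChar, MulChar.mul_apply, MulChar.inv_apply_eq_inv', homega,
      angle_of_isUnit ha, map_div₀, div_pow, div_eq_inv_mul, mul_assoc]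
  · rw [extendChar_eq_zero _ ha, extendChar_eq_zero _ ha, zero_mul, zero_mul]

theorem volkenbornSum_extendChar_mul_pow (m N : ℕ) :
    volkenbornSum (fun a ↦ extendChar χ a * algebraMap ℚ_[p] ℂ_[p] a ^ m) (N + 1) =
      ((p : ℂ_[p]) ^ (N + 1))⁻¹ * charPowerSum χ m (p ^ (N + 1)) := by
  have extendChar_zero : extendChar χ (0 : ℕ) = 0 :=
    extendChar_eq_zero χ (by simp)
  have extendChar_prime_pow : extendChar χ (p ^ (N + 1) : ℕ) = 0 := by
    refine extendChar_eq_zero χ ?_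
    rw [PadicInt.isUnit_iff, Nat.cast_pow, norm_pow, PadicInt.norm_p]
    exact (pow_lt_one₀ (by positivity) inv_prime_lt_one N.succ_ne_zero).ne
  have hsum := (Finset.sum_range_succ (fun a : ℕ ↦ extendChar χ a *
    algebraMap ℚ_[p] ℂ_[p] (a : ℤ_[p]) ^ m) (p ^ (N + 1))).symm.trans (Finset.sum_range_succ' _ _)
  rw [extendChar_zero, extendChar_prime_pow, zero_mul, zero_mul, add_zero, add_zero] at hsum
  rw [volkenbornSum, charPowerSum, hsum, sum_Icc_one_eq_sum_range]
  simp only [extendChar, map_natCast, PadicInt.coe_natCast]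

theorem tendsto_volkenbornSum_angle_pow (m : ℕ) :
    Tendsto (volkenbornSum fun a ↦ extendChar χ a * algebraMap ℚ_[p] ℂ_[p] (angle a) ^ m) atTop
      (𝓝 (interpolationValue χ m)) := by
  simp only [← extendChar_mul_inv_omega_pow_mul_pow]
  rw [← tendsto_add_atTop_iff_nat 1]
  simp only [volkenbornSum_extendChar_mul_pow]
  exact (tendsto_add_atTop_iff_nat 1).mpr (tendsto_charPowerSum_interpolationValue χ m)

theorem norm_pow_sub_pow_mul_le {K : Type*} [NormedField K] [IsUltrametricDist K] {x y : K}
    {r : ℝ} (hx : ‖x‖ ≤ r) (hy : ‖y‖ ≤ r) (n : ℕ) :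
    ‖x ^ n - y ^ n‖ * r ≤ r ^ n * ‖x - y‖ := by
  have hr : 0 ≤ r := (norm_nonneg x).trans hx
  induction n with
  | zero => simp
  | succ n ih =>
    have hsplit : x ^ (n + 1) - y ^ (n + 1) = x ^ n * (x - y) + (x ^ n - y ^ n) * y := by ring
    have hleft : ‖x ^ n * (x - y)‖ ≤ r ^ n * ‖x - y‖ := by
      rw [norm_mul, norm_pow]
      gcongr
    have hright : ‖(x ^ n - y ^ n) * y‖ ≤ r ^ n * ‖x - y‖ := by
      rw [norm_mul]
      exact (mul_le_mul_of_nonneg_left hy (norm_nonneg _)).trans ih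
    calc ‖x ^ (n + 1) - y ^ (n + 1)‖ * r ≤ r ^ n * ‖x - y‖ * r := by
          rw [hsplit]
          gcongr
          exact (IsUltrametricDist.norm_add_le_max _ _).trans (max_le hleft hright)
      _ = r ^ (n + 1) * ‖x - y‖ := by ring

theorem tendsto_fwdDiff_iter {ι G : Type*} [AddCommGroup G] [TopologicalSpace G]
    [IsTopologicalAddGroup G] {l : Filter ι} {F : ι → ℕ → G} {b : ℕ → G}
    (h : ∀ m, Tendsto (fun i ↦ F i m) l (𝓝 (b m))) (n m : ℕ) :
    Tendsto (fun i ↦ (fwdDiff 1)^[n] (F i) m) l (𝓝 ((fwdDiff 1)^[n] b m)) := by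
  simp only [fwdDiff_iter_eq_sum_shift]
  exact tendsto_finsetSum _ fun k _ ↦ (h _).const_smul _

theorem fwdDiff_iter_volkenbornSum (f g : ℤ_[p] → ℂ_[p]) (N n : ℕ) :
    (fwdDiff 1)^[n] (fun m ↦ volkenbornSum (fun a ↦ f a * g a ^ m) N) 0 =
      volkenbornSum (fun a ↦ f a * (g a - 1) ^ n) N := by
  induction n generalizing f with
  | zero => simp
  | succ n ih =>
    have hstep : fwdDiff 1 (fun m ↦ volkenbornSum (fun a ↦ f a * g a ^ m) N) =
        fun m ↦ volkenbornSum (fun a ↦ f a * (g a - 1) * g a ^ m) N := by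
      funext m
      rw [fwdDiff, volkenbornSum, volkenbornSum, volkenbornSum, ← mul_sub,
        ← Finset.sum_sub_distrib]
      congr! 2
      ring
    rw [Function.iterate_succ_apply, hstep, ih]
    simp only [pow_succ', mul_assoc]

theorem hasSum_volkenbornSum {F : ℕ → ℤ_[p] → ℂ_[p]} {f : ℤ_[p] → ℂ_[p]}
    (hF : ∀ a, HasSum (fun n ↦ F n a) (f a)) (N : ℕ) :
    HasSum (fun n ↦ volkenbornSum (F n) N) (volkenbornSum f N) := by
  simp only [volkenbornSum]
  exact (hasSum_sum fun (a : ℕ) _ ↦ hF a).mul_left _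

theorem norm_algebraMap_angle_sub_one_le (a : ℤ_[p]) :
    ‖algebraMap ℚ_[p] ℂ_[p] (angle a) - 1‖ ≤ (p : ℝ)⁻¹ := by
  rw [← map_one (algebraMap ℚ_[p] ℂ_[p]), ← map_sub, norm_algebraMap']
  exact norm_angle_sub_one_le a

/-- The coefficient `χ(a) (⟨a⟩ - 1) ^ n` of `binom(t, n)` in the binomial expansion of
`χ(a) ⟨a⟩ ^ t`. -/
def angleTerm (n : ℕ) (a : ℤ_[p]) : ℂ_[p] :=
  extendChar χ a * (algebraMap ℚ_[p] ℂ_[p] (angle a) - 1) ^ n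

theorem angleTerm_zero_right (n : ℕ) : angleTerm χ n 0 = 0 := by
  rw [angleTerm, extendChar_eq_zero χ not_isUnit_zero, zero_mul]

theorem norm_angleTerm_le (n : ℕ) (a : ℤ_[p]) : ‖angleTerm χ n a‖ ≤ (p : ℝ)⁻¹ ^ n := by
  rw [angleTerm, norm_mul, norm_pow]
  exact (mul_le_of_le_one_left (by positivity) (norm_extendChar_le_one χ a)).trans
    (pow_le_pow_left₀ (norm_nonneg _) (norm_algebraMap_angle_sub_one_le a) n)

theorem norm_angleTerm_sub_le_of_toZModPow_eq (n : ℕ) {a b : ℤ_[p]}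
    (hab : PadicInt.toZModPow (v + 1) a = PadicInt.toZModPow (v + 1) b) :
    ‖angleTerm χ n a - angleTerm χ n b‖ ≤ p * (p : ℝ)⁻¹ ^ n * ‖a - b‖ := by
  have hchar : extendChar χ a = extendChar χ b := congrArg χ hab
  rw [angleTerm, angleTerm, ← hchar, ← mul_sub, norm_mul]
  by_cases ha : IsUnit a
  · have hangle : ‖(algebraMap ℚ_[p] ℂ_[p] (angle a) - 1) -
        (algebraMap ℚ_[p] ℂ_[p] (angle b) - 1)‖ = ‖a - b‖ := by
      rw [sub_sub_sub_cancel_right, ← map_sub, norm_algebraMap',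
        norm_angle_sub_angle ha (by rw [← castHom_toZModPow v, hab, castHom_toZModPow])]
    have hpow := norm_pow_sub_pow_mul_le (norm_algebraMap_angle_sub_one_le a)
      (norm_algebraMap_angle_sub_one_le b) n
    rw [hangle, ← div_eq_mul_inv,
      div_le_iff₀ (Nat.cast_pos.mpr hp.out.pos)] at hpow
    exact (mul_le_of_le_one_left (norm_nonneg _) (norm_extendChar_le_one χ a)).trans
      (hpow.trans_eq (by ring))
  · rw [extendChar_eq_zero χ ha, norm_zero, zero_mul]
    positivity

theorem lipschitzWith_angleTerm (n : ℕ) :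
    LipschitzWith ((p : NNReal) ^ (v + 1) * (p : NNReal)⁻¹ ^ n) (angleTerm χ n) := by
  refine LipschitzWith.of_dist_le_mul fun a b ↦ ?_
  rw [dist_eq_norm, dist_eq_norm]
  push_cast
  have hp1 : (1 : ℝ) ≤ p := Nat.one_le_cast.mpr hp.out.one_le
  by_cases hab : PadicInt.toZModPow (v + 1) a = PadicInt.toZModPow (v + 1) b
  · refine (norm_angleTerm_sub_le_of_toZModPow_eq χ n hab).trans ?_
    gcongr
    exact le_self_pow₀ hp1 v.succ_ne_zero
  · have hfar : ((p : ℝ) ^ (v + 1))⁻¹ ≤ ‖a - b‖ := by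
      rw [← sub_eq_zero, ← map_sub, ← RingHom.mem_ker, PadicInt.ker_toZModPow,
        ← PadicInt.norm_le_pow_iff_mem_span_pow, not_le, zpow_neg, zpow_natCast] at hab
      exact hab.le
    calc ‖angleTerm χ n a - angleTerm χ n b‖
        ≤ max ‖angleTerm χ n a‖ ‖-angleTerm χ n b‖ := by
          rw [sub_eq_add_neg]
          exact IsUltrametricDist.norm_add_le_max _ _
      _ ≤ (p : ℝ)⁻¹ ^ n := by
          rw [norm_neg]
          exact max_le (norm_angleTerm_le χ n a) (norm_angleTerm_le χ n b)
      _ = (p : ℝ) ^ (v + 1) * (p : ℝ)⁻¹ ^ n * ((p : ℝ) ^ (v + 1))⁻¹ := by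
          field_simp
      _ ≤ _ := by gcongr

theorem norm_volkenbornSum_angleTerm_le (n N : ℕ) :
    ‖volkenbornSum (angleTerm χ n) N‖ ≤ (p : ℝ) ^ (v + 2) * (p : ℝ)⁻¹ ^ n := by
  refine (norm_volkenbornSum_le (lipschitzWith_angleTerm χ n) N).trans_eq ?_
  rw [angleTerm_zero_right, norm_zero, max_eq_right (by positivity)]
  push_cast
  ring

/-- The Mahler coefficients `c_n` of the function `A_χ` interpolating the numbers `b_n`. -/
def interpolationCoeff (n : ℕ) : ℂ_[p] := (fwdDiff 1)^[n] (interpolationValue χ) 0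

theorem tendsto_volkenbornSum_angleTerm (n : ℕ) :
    Tendsto (volkenbornSum (angleTerm χ n)) atTop (𝓝 (interpolationCoeff χ n)) :=
  (tendsto_fwdDiff_iter (tendsto_volkenbornSum_angle_pow χ) n 0).congr fun N ↦
    fwdDiff_iter_volkenbornSum (extendChar χ) _ N n

theorem norm_interpolationCoeff_le (n : ℕ) :
    ‖interpolationCoeff χ n‖ ≤ (p : ℝ) ^ (v + 2) * (p : ℝ)⁻¹ ^ n :=
  le_of_tendsto (tendsto_volkenbornSum_angleTerm χ n).norm
    (.of_forall (norm_volkenbornSum_angleTerm_le χ n))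

theorem summable_norm_interpolationCoeff_div (hp2 : p ≠ 2) :
    Summable fun n ↦ ‖interpolationCoeff χ n‖ / ‖(n.factorial : ℂ_[p])‖ :=
  summable_norm_div_norm_factorial hp2 (norm_interpolationCoeff_le χ)

theorem summable_interpolationTerm (hp2 : p ≠ 2) {t : ℂ_[p]} (ht : ‖t‖ ≤ 1) :
    Summable (interpolationTerm χ t) :=
  summable_mul_choose (summable_norm_interpolationCoeff_div χ hp2) ht

theorem summable_anglePowTerm (hp2 : p ≠ 2) {t : ℂ_[p]} (ht : ‖t‖ ≤ 1) (a : ℤ_[p]) :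
    Summable (anglePowTerm a t) := by
  have hcoeff : ∀ n, ‖(algebraMap ℚ_[p] ℂ_[p] (angle a) - 1) ^ n‖ ≤ 1 * (p : ℝ)⁻¹ ^ n := fun n ↦ by
    rw [one_mul, norm_pow]
    exact pow_le_pow_left₀ (norm_nonneg _) (norm_algebraMap_angle_sub_one_le a) n
  exact (summable_mul_choose (summable_norm_div_norm_factorial hp2 hcoeff) ht).congr fun n ↦
    mul_comm _ _

theorem hasSum_hurwitzIntegrand (hp2 : p ≠ 2) {t : ℂ_[p]} (ht : ‖t‖ ≤ 1) (a : ℤ_[p]) :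
    HasSum (fun n ↦ angleTerm χ n a * Ring.choose t n) (hurwitzIntegrand (1 - t) χ 0 a) := by
  rw [hurwitzIntegrand, zero_add, sub_sub_cancel]
  have hterm (n : ℕ) :
      angleTerm χ n a * Ring.choose t n = extendChar χ a * anglePowTerm a t n := by
    rw [angleTerm, anglePowTerm, mul_assoc, mul_comm (Ring.choose t n)]
  simp only [hterm]
  exact (summable_anglePowTerm hp2 ht a).hasSum.mul_left (extendChar χ a)

/- The Volkenborn integral commutes with the binomial expansion of `⟨a⟩ ^ t`: the sums over
`[0, p ^ N)` of the `n`-th term decay geometrically in `n`, uniformly in `N`. -/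
theorem tendsto_volkenbornSum_hurwitzIntegrand (hp2 : p ≠ 2) {t : ℂ_[p]} (ht : ‖t‖ ≤ 1) :
    Tendsto (volkenbornSum (hurwitzIntegrand (1 - t) χ 0)) atTop
      (𝓝 (newtonSeries (interpolationCoeff χ) t)) := by
  have hexpand (N : ℕ) : volkenbornSum (hurwitzIntegrand (1 - t) χ 0) N =
      ∑' n, volkenbornSum (angleTerm χ n) N * Ring.choose t n := by
    rw [← (hasSum_volkenbornSum (hasSum_hurwitzIntegrand χ hp2 ht) N).tsum_eq]
    simp only [volkenbornSum, mul_assoc, Finset.sum_mul]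
  refine Tendsto.congr (fun N ↦ (hexpand N).symm) (tendsto_tsum_of_dominated_convergence
    ((summable_inv_pow_div_norm_factorial hp2).mul_left ((p : ℝ) ^ (v + 2)))
    (fun n ↦ (tendsto_volkenbornSum_angleTerm χ n).mul_const _) (.of_forall fun N n ↦ ?_))
  refine (norm_mul_choose_le _ ht n).trans ?_
  rw [← mul_div_assoc]
  gcongr
  exact norm_volkenbornSum_angleTerm_le χ n N

theorem volkenbornIntegral_hurwitzIntegrand (hp2 : p ≠ 2) {t : ℂ_[p]} (ht : ‖t‖ ≤ 1) :
    volkenbornIntegral (hurwitzIntegrand (1 - t) χ 0) = newtonSeries (interpolationCoeff χ) t :=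
  (tendsto_volkenbornSum_hurwitzIntegrand χ hp2 ht).limUnder_eq

/-! ### Comparison of `ζ_p` and `L_p` -/

theorem extendAtOne_congr {f g : ℂ_[p] → ℂ_[p]} {z : ℂ_[p]} (hz : f z = g z)
    (hfg : f =ᶠ[𝓝[≠] 1] g) : extendAtOne f z = extendAtOne g z := by
  rcases eq_or_ne z 1 with rfl | hz1
  · simp only [extendAtOne, Function.update_self, limUnder, map_congr hfg]
  · rw [extendAtOne_of_ne _ hz1, extendAtOne_of_ne _ hz1, hz]

theorem continuousAt_extendAtOne_of_ne {f : ℂ_[p] → ℂ_[p]} {z : ℂ_[p]} (hz : z ≠ 1)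
    (hf : ContinuousAt f z) : ContinuousAt (extendAtOne f) z := by
  classical
  exact (continuousAt_update_of_ne hz).mpr hf

theorem continuousAt_extendAtOne_one {f : ℂ_[p] → ℂ_[p]} (hf : ∃ y, Tendsto f (𝓝[≠] 1) (𝓝 y)) :
    ContinuousAt (extendAtOne f) 1 := by
  classical
  exact continuousAt_update_same.mpr (tendsto_nhds_limUnder hf)

theorem continuousAt_extendAtOne_sub_one_inv_mul {g : ℂ_[p] → ℂ_[p]}
    (hg : DifferentiableAt ℂ_[p] g 1) (h1 : g 1 = 0) :
    ContinuousAt (extendAtOne fun z ↦ (z - 1)⁻¹ * g z) 1 := by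
  refine continuousAt_extendAtOne_one ⟨deriv g 1, ?_⟩
  refine (hasDerivAt_iff_tendsto_slope.mp hg.hasDerivAt).congr fun z ↦ ?_
  rw [slope_def_field, h1, sub_zero, div_eq_inv_mul]

theorem closedBall_zero_one_mem_nhds {t : ℂ_[p]} (ht : ‖t‖ ≤ 1) :
    Metric.closedBall (0 : ℂ_[p]) 1 ∈ 𝓝 t :=
  (IsUltrametricDist.isOpen_closedBall 0 one_ne_zero).mem_nhds (mem_closedBall_zero_iff.mpr ht)

theorem hurwitzZeta_eq_padicL (hp2 : p ≠ 2) {z : ℂ_[p]} (hz : ‖1 - z‖ ≤ 1) :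
    hurwitzZeta z χ 0 = padicL z χ := by
  have integral_eq {w : ℂ_[p]} (hw : ‖1 - w‖ ≤ 1) :
      (w - 1)⁻¹ * volkenbornIntegral (hurwitzIntegrand w χ 0) =
        (w - 1)⁻¹ * newtonSeries (interpolationCoeff χ) (1 - w) := by
    rw [← volkenbornIntegral_hurwitzIntegrand χ hp2 hw, sub_sub_cancel]
  refine extendAtOne_congr (integral_eq hz) (Filter.Eventually.filter_mono nhdsWithin_le_nhds ?_)
  filter_upwards [Metric.closedBall_mem_nhds (1 : ℂ_[p]) one_pos] with w hw
  exact integral_eq (by rwa [← dist_eq_norm'])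

theorem sum_Icc_one_natCast_zmod {M : Type*} [AddCommMonoid M] (f : ℕ) [NeZero f]
    (g : ZMod f → M) : ∑ a ∈ Finset.Icc 1 f, g a = ∑ x, g x := by
  rw [sum_Icc_one_eq_sum_range]
  refine Finset.sum_bij' (fun a _ ↦ ((a + 1 : ℕ) : ZMod f)) (fun x _ ↦ (x - 1).val) (by simp)
    (fun x _ ↦ Finset.mem_range.mpr (ZMod.val_lt _)) (fun a ha ↦ ?_) (by simp) (by simp)
  rw [Nat.cast_succ, add_sub_cancel_right, ZMod.val_cast_of_lt (Finset.mem_range.mp ha)]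

theorem generalizedBernoulli_zero {f : ℕ} [NeZero f] {ψ : DirichletCharacter ℂ_[p] f}
    (hψ : ψ ≠ 1) : generalizedBernoulli ψ 0 = 0 := by
  simp [generalizedBernoulli, sum_Icc_one_natCast_zmod f ψ, MulChar.sum_eq_zero_of_ne_one hψ]

theorem interpolationValue_zero {χ : DirichletCharacter ℂ_[p] (p ^ (v + 1))} (hχ : χ ≠ 1) :
    interpolationValue χ 0 = 0 := by
  have hψ : χ.primitiveCharacter ≠ 1 := fun h ↦ hχ <| by
    rw [← χ.changeLevel_primitiveCharacter, h, DirichletCharacter.changeLevel_one]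
  have : NeZero χ.conductor := ⟨χ.conductor_ne_zero⟩
  simp only [interpolationValue]
  rw [pow_zero, inv_one, mul_one, generalizedBernoulli_zero hψ, mul_zero]

theorem newtonSeries_interpolationCoeff_zero :
    newtonSeries (interpolationCoeff χ) 0 = interpolationValue χ 0 := by
  rw [← tsum_interpolationTerm_natCast, Nat.cast_zero]
  rfl

theorem continuousAt_padicL (hp2 : p ≠ 2) {z : ℂ_[p]} (hz : ‖1 - z‖ ≤ 1) (hχ : z = 1 → χ ≠ 1) :
    ContinuousAt (fun w ↦ padicL w χ) z := by
  have hc := summable_norm_interpolationCoeff_div χ hp2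
  rcases eq_or_ne z 1 with rfl | hz1
  · refine continuousAt_extendAtOne_sub_one_inv_mul
      (g := fun w ↦ newtonSeries (interpolationCoeff χ) (1 - w)) ?_ ?_
    · rw [differentiableAt_comp_const_sub, sub_self]
      exact differentiableAt_newtonSeries_zero hc
    · simp only [sub_self, newtonSeries_interpolationCoeff_zero,
        interpolationValue_zero (hχ rfl)]
  · have hseries : ContinuousAt (newtonSeries (interpolationCoeff χ)) (1 - z) :=
      (continuousOn_newtonSeries hc).continuousAt (closedBall_zero_one_mem_nhds hz)
    exact continuousAt_extendAtOne_of_ne hz1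
      (((continuousAt_id.sub continuousAt_const).inv₀ (sub_ne_zero.mpr hz1)).mul
        (hseries.comp (continuousAt_const.sub continuousAt_id)))

theorem continuousAt_hurwitzZeta_one (hp2 : p ≠ 2) (hχ : χ ≠ 1) :
    ContinuousAt (fun z ↦ hurwitzZeta z χ 0) 1 := by
  refine (continuousAt_padicL χ hp2 (by simp) fun _ ↦ hχ).congr ?_
  filter_upwards [Metric.closedBall_mem_nhds (1 : ℂ_[p]) one_pos] with z hz
  exact (hurwitzZeta_eq_padicL χ hp2 (by rwa [← dist_eq_norm'])).symm

end Twist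

/-! ### The constant term of the Eisenstein series -/

theorem generalizedBernoulli_of_level_eq_one {f : ℕ} (hf : f = 1)
    (ψ : DirichletCharacter ℂ_[p] f) (n : ℕ) :
    generalizedBernoulli ψ n = ((bernoulli' n : ℚ) : ℂ_[p]) := by
  subst hf
  have hψ (a : ZMod 1) : ψ a = 1 := by
    rw [Subsingleton.elim a 1, map_one]
  simp [generalizedBernoulli, hψ, ← Polynomial.bernoulli_eval_one, Polynomial.aeval_def]

theorem interpolationValue_omega_pow (v n : ℕ) :
    interpolationValue (omega p v ^ n) n =
      (1 - (p : ℂ_[p]) ^ ((n : ℤ) - 1)) * ((bernoulli' n : ℚ) : ℂ_[p]) := by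
  have hcond : (1 : DirichletCharacter ℂ_[p] (p ^ (v + 1))).conductor = 1 :=
    DirichletCharacter.conductor_one
  have : Subsingleton (ZMod (1 : DirichletCharacter ℂ_[p] (p ^ (v + 1))).conductor) := by
    rw [hcond]
    infer_instance
  simp only [interpolationValue]
  rw [mul_inv_cancel, generalizedBernoulli_of_level_eq_one hcond,
    DirichletCharacter.primitiveCharacter_one, MulChar.one_apply (isUnit_of_subsingleton _),
    one_mul]

/- The factor `1 - p ^ (k - 1)` removes the Euler factor at `p` from `ζ(1 - k)`. -/
theorem half_mul_padicL_one_sub_natCast (v : ℕ) {k : ℕ} (hk : 1 < k) :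
    1 / 2 * padicL (1 - (k : ℂ_[p])) (omega p v ^ k) =
      (1 - (p : ℂ_[p]) ^ (k - 1)) * ((PowerSeries.coeff 0 (eisensteinQExp k) : ℚ) : ℂ_[p]) := by
  have hzpow : (p : ℂ_[p]) ^ ((k : ℤ) - 1) = (p : ℂ_[p]) ^ (k - 1) := by
    rw [← zpow_natCast, Nat.cast_sub hk.le, Nat.cast_one]
  rw [padicL_one_sub_natCast _ k (Nat.ne_zero_of_lt hk), interpolationValue_omega_pow,
    eisensteinQExp, PowerSeries.coeff_mk, if_pos rfl, bernoulli_eq_bernoulli'_of_ne_one hk.ne',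
    hzpow]
  push_cast
  ring

theorem teichmullerChar_injective : Function.Injective (teichmullerChar p) :=
  (algebraMap ℚ_[p] ℂ_[p]).injective.comp
    (Subtype.coe_injective.comp (Function.LeftInverse.injective (toZMod_teichmullerLift p)))

theorem teichmullerChar_pow_eq_one_iff (n : ℕ) : teichmullerChar p ^ n = 1 ↔ p - 1 ∣ n := by
  have hcard := FiniteField.forall_pow_eq_one_iff (ZMod p) n
  rw [ZMod.card] at hcard
  rw [← hcard, MulChar.ext_iff]
  refine forall_congr' fun x ↦ ?_
  rw [MulChar.pow_apply_coe, MulChar.one_apply_coe, ← map_pow,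
    map_eq_one_iff _ teichmullerChar_injective, ← Units.val_pow_eq_pow_val, Units.val_eq_one]

theorem orderOf_omega (v : ℕ) : orderOf (omega p v) = p - 1 := by
  have hlevel : orderOf (omega p v) = orderOf (teichmullerChar p) :=
    orderOf_injective _ (DirichletCharacter.changeLevel_injective _) _
  refine hlevel.trans (Nat.dvd_right_iff_eq.mp fun n ↦ ?_)
  rw [orderOf_dvd_iff_pow_eq_one, teichmullerChar_pow_eq_one_iff]

theorem omega_pow_eq_omega_pow_iff (v : ℕ) {a b : ℕ} :
    omega p v ^ a = omega p v ^ b ↔ (a : ZMod (p - 1)) = b := by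
  rw [pow_eq_pow_iff_modEq, orderOf_omega, ZMod.natCast_eq_natCast_iff]

instance neZero_prime_sub_one : NeZero (p - 1) := ⟨Nat.sub_ne_zero_of_lt hp.out.one_lt⟩

theorem omega_pow_val_eq (v : ℕ) {u : ZMod (p - 1)} {k : ℕ} (hk : (k : ZMod (p - 1)) = u) :
    omega p v ^ u.val = omega p v ^ k := by
  rw [omega_pow_eq_omega_pow_iff, ZMod.natCast_zmod_val, hk]

theorem omega_pow_val_ne_one (v : ℕ) {u : ZMod (p - 1)} (hu : u ≠ 0) :
    omega p v ^ u.val ≠ 1 := by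
  rwa [← pow_zero (omega p v), Ne, omega_pow_eq_omega_pow_iff, ZMod.natCast_zmod_val,
    Nat.cast_zero]

theorem even_of_even_natCast_zmod {n k : ℕ} (hn : Even n) (hk : Even (k : ZMod n)) : Even k := by
  obtain ⟨r, hr⟩ := hk.map (ZMod.castHom hn.two_dvd (ZMod 2))
  rw [map_natCast, CharTwo.add_self_eq_zero] at hr
  exact even_iff_two_dvd.mpr ((ZMod.natCast_eq_zero_iff k 2).mp hr)

theorem norm_sub_appr_le (s : ℤ_[p]) (N : ℕ) : ‖s - s.appr N‖ ≤ (p : ℝ)⁻¹ ^ N := by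
  rw [inv_pow, ← zpow_natCast, ← zpow_neg]
  exact (PadicInt.norm_le_pow_iff_mem_span_pow _ N).mpr (PadicInt.appr_spec N s)

theorem tendsto_appr_add_prime_pow_mul (s : ℤ_[p]) (m : ℕ → ℕ) :
    Tendsto (fun N ↦ ((s.appr N + p ^ N * m N : ℕ) : ℤ_[p])) atTop (𝓝 s) := by
  refine tendsto_iff_norm_sub_tendsto_zero.mpr (squeeze_zero (fun _ ↦ norm_nonneg _) (fun N ↦ ?_)
    (tendsto_pow_atTop_nhds_zero_of_lt_one (by positivity) (inv_prime_lt_one (p := p))))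
  have hmul : ‖(p : ℤ_[p]) ^ N * m N‖ ≤ (p : ℝ)⁻¹ ^ N := by
    rw [norm_mul, norm_pow, PadicInt.norm_p]
    exact mul_le_of_le_one_right (by positivity) (PadicInt.norm_le_one _)
  have hsplit : ((s.appr N + p ^ N * m N : ℕ) : ℤ_[p]) - s =
      -(s - s.appr N) + (p : ℤ_[p]) ^ N * m N := by
    push_cast
    ring
  rw [hsplit]
  exact (IsUltrametricDist.norm_add_le_max _ _).trans
    (max_le ((norm_neg _).trans_le (norm_sub_appr_le s N)) hmul)

/- Since `p ≡ 1` modulo `p - 1`, the weights `s_N + p ^ N m_N`, with `s_N` the truncation of `s`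
modulo `p ^ N` and `m_N ≡ u - s_N`, have limit `s` in `ℤ_p` and residue `u` modulo `p - 1`. -/
theorem neBot_weightFilter (hp2 : p ≠ 2) (s : ℤ_[p]) {u : ZMod (p - 1)} (hu : Even u) :
    (weightFilter s u).NeBot := by
  set m : ℕ → ℕ := fun N ↦ (u - s.appr N).val + (p - 1)
  set k : ℕ → ℕ := fun N ↦ s.appr N + p ^ N * m N
  have hk_atTop : Tendsto k atTop atTop := by
    refine tendsto_atTop_mono (fun N ↦ ?_) tendsto_id
    calc N ≤ p ^ N := (Nat.lt_pow_self hp.out.one_lt).le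
      _ ≤ p ^ N * m N :=
        Nat.le_mul_of_pos_right _ (Nat.add_pos_right _ (Nat.sub_pos_of_lt hp.out.one_lt))
      _ ≤ k N := Nat.le_add_left _ _
  have hk_residue (N : ℕ) : (k N : ZMod (p - 1)) = u := by
    have hp1 : (p : ZMod (p - 1)) = 1 := by
      rw [← Nat.sub_add_cancel hp.out.one_le, Nat.cast_add, Nat.add_sub_cancel, ZMod.natCast_self,
        zero_add, Nat.cast_one]
    simp only [k, m, Nat.cast_add, Nat.cast_mul, Nat.cast_pow, hp1, one_pow, one_mul,
      ZMod.natCast_self, add_zero, ZMod.natCast_zmod_val, add_sub_cancel]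
  have hk_even (N : ℕ) : Even (k N) :=
    even_of_even_natCast_zmod (hp.out.even_sub_one hp2) ((hk_residue N).symm ▸ hu)
  exact Tendsto.neBot (tendsto_inf.mpr ⟨tendsto_inf.mpr ⟨hk_atTop,
    tendsto_comap_iff.mpr (tendsto_appr_add_prime_pow_mul s m)⟩,
    tendsto_principal.mpr (.of_forall fun N ↦ ⟨hk_even N, hk_residue N⟩)⟩)

theorem weightFilter_le_atTop (s : ℤ_[p]) (u : ZMod (p - 1)) : weightFilter s u ≤ atTop :=
  inf_le_left.trans inf_le_left

theorem eventually_natCast_eq_weightFilter (s : ℤ_[p]) (u : ZMod (p - 1)) :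
    ∀ᶠ k : ℕ in weightFilter s u, (k : ZMod (p - 1)) = u :=
  (inf_le_right : weightFilter s u ≤ _) (mem_principal.mpr fun _ h ↦ h.2)

theorem tendsto_natCast_weightFilter (s : ℤ_[p]) (u : ZMod (p - 1)) :
    Tendsto (fun k : ℕ ↦ (k : ℂ_[p])) (weightFilter s u) (𝓝 (algebraMap ℚ_[p] ℂ_[p] s)) := by
  have hcont : Continuous fun a : ℤ_[p] ↦ algebraMap ℚ_[p] ℂ_[p] a :=
    (algebraMap_isometry ℚ_[p] ℂ_[p]).continuous.comp continuous_subtype_val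
  have hk : Tendsto (fun k : ℕ ↦ (k : ℤ_[p])) (weightFilter s u) (𝓝 s) :=
    tendsto_comap.mono_left (inf_le_left.trans inf_le_right)
  simpa only [Function.comp_def, PadicInt.coe_natCast, map_natCast] using
    (hcont.tendsto s).comp hk

theorem norm_algebraMap_padicInt_le_one (s : ℤ_[p]) : ‖algebraMap ℚ_[p] ℂ_[p] s‖ ≤ 1 := by
  rw [norm_algebraMap']
  exact s.2

theorem tendsto_coeff_zero_eisensteinQExp (hp2 : p ≠ 2) (v : ℕ) {s : ℤ_[p]} {u : ZMod (p - 1)}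
    (hsu : ¬(s = 0 ∧ u = 0)) :
    Tendsto (fun k ↦ ((PowerSeries.coeff 0 (eisensteinQExp k) : ℚ) : ℂ_[p])) (weightFilter s u)
      (𝓝 (1 / 2 * padicL (1 - algebraMap ℚ_[p] ℂ_[p] s) (omega p v ^ u.val))) := by
  have heuler : Tendsto (fun k : ℕ ↦ 1 - (p : ℂ_[p]) ^ (k - 1)) (weightFilter s u) (𝓝 1) := by
    have h := ((tendsto_prime_pow (p := p)).comp (tendsto_sub_atTop_nat 1)).const_sub 1
    rw [sub_zero] at h
    exact h.mono_left (weightFilter_le_atTop s u)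
  have hne_one : 1 - algebraMap ℚ_[p] ℂ_[p] s = 1 → omega p v ^ u.val ≠ 1 := fun h ↦
    omega_pow_val_ne_one v fun hu ↦ hsu ⟨by simpa using h, hu⟩
  have hL : Tendsto (fun k : ℕ ↦ padicL (1 - (k : ℂ_[p])) (omega p v ^ u.val)) (weightFilter s u)
      (𝓝 (padicL (1 - algebraMap ℚ_[p] ℂ_[p] s) (omega p v ^ u.val))) :=
    (continuousAt_padicL _ hp2
      (by simpa only [sub_sub_cancel] using norm_algebraMap_padicInt_le_one s) hne_one).tendsto.comp
      ((tendsto_natCast_weightFilter s u).const_sub 1)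
  have hquot := (hL.const_mul (1 / 2)).div heuler one_ne_zero
  rw [div_one] at hquot
  refine hquot.congr' ?_
  filter_upwards [weightFilter_le_atTop s u (eventually_gt_atTop 1),
    heuler.eventually_ne one_ne_zero, eventually_natCast_eq_weightFilter s u] with k hk hne hku
  rw [Pi.div_apply, omega_pow_val_eq v hku, half_mul_padicL_one_sub_natCast v hk,
    mul_div_cancel_left₀ _ hne]

theorem exists_tendsto_of_tendsto_algebraMap {ι : Type*} {l : Filter ι} [l.NeBot]
    {f : ι → ℚ_[p]} {y : ℂ_[p]} (h : Tendsto (fun i ↦ algebraMap ℚ_[p] ℂ_[p] (f i)) l (𝓝 y)) :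
    ∃ x, algebraMap ℚ_[p] ℂ_[p] x = y ∧ Tendsto f l (𝓝 x) := by
  have hemb : IsClosedEmbedding (algebraMap ℚ_[p] ℂ_[p]) :=
    (algebraMap_isometry ℚ_[p] ℂ_[p]).isClosedEmbedding
  obtain ⟨x, rfl⟩ := hemb.isClosed_range.mem_of_tendsto h (.of_forall fun i ↦ ⟨f i, rfl⟩)
  exact ⟨x, rfl, hemb.isEmbedding.tendsto_nhds_iff.mpr h⟩

theorem coeff_zero_padicEisenstein (hp2 : p ≠ 2) (v : ℕ) {s : ℤ_[p]} {u : ZMod (p - 1)}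
    (hu : Even u) (hsu : ¬(s = 0 ∧ u = 0)) :
    algebraMap ℚ_[p] ℂ_[p] (PowerSeries.coeff 0 (padicEisenstein s u)) =
        1 / 2 * padicL (1 - algebraMap ℚ_[p] ℂ_[p] s) (omega p v ^ u.val) ∧
      Tendsto (fun k : ℕ ↦ ((PowerSeries.coeff 0 (eisensteinQExp k) : ℚ) : ℚ_[p]))
        (weightFilter s u) (𝓝 (PowerSeries.coeff 0 (padicEisenstein s u))) := by
  have := neBot_weightFilter hp2 s hu
  obtain ⟨x, hx, hlim⟩ := exists_tendsto_of_tendsto_algebraMap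
    ((tendsto_coeff_zero_eisensteinQExp hp2 v hsu).congr fun k ↦ (map_ratCast _ _).symm)
  have hcoeff : PowerSeries.coeff 0 (padicEisenstein s u) = x := by
    rw [padicEisenstein, PowerSeries.coeff_mk]
    exact hlim.limUnder_eq
  rw [hcoeff]
  exact ⟨hx, hlim⟩

end PadicEisenstein

end

open PadicEisenstein in
theorem proposition2p3 (p : ℕ) [Fact p.Prime] (hp : p ≠ 2) (s : ℤ_[p]) (u : ZMod (p - 1))
    (hu : Even u) (hsu : ¬(s = 0 ∧ u = 0)) :
    -- the constant terms agree, and both are `½ L_p(1 - s, ω ^ u)`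
    constantTerm (algebraMap ℚ_[p] ℂ_[p] s) (omega p 0 ^ u.val) 0 =
        algebraMap ℚ_[p] ℂ_[p] (PowerSeries.coeff 0 (padicEisenstein s u)) ∧
      algebraMap ℚ_[p] ℂ_[p] (PowerSeries.coeff 0 (padicEisenstein s u)) =
        1 / 2 * padicL (1 - algebraMap ℚ_[p] ℂ_[p] s) (omega p 0 ^ u.val) ∧
      -- the limit defining the constant term of `G*_{s,u}` exists
      Tendsto (fun k : ℕ ↦ ((PowerSeries.coeff 0 (eisensteinQExp k) : ℚ) : ℚ_[p]))
        (weightFilter s u) (𝓝 (PowerSeries.coeff 0 (padicEisenstein s u))) ∧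
      -- for `s ≠ 0` the series and the integral defining the two functions at `1 - s` converge
      (s ≠ 0 →
        (∀ a : ℤ_[p], a ≠ 0 → Summable (anglePowTerm a (algebraMap ℚ_[p] ℂ_[p] s))) ∧
        Tendsto
          (volkenbornSum (hurwitzIntegrand (1 - algebraMap ℚ_[p] ℂ_[p] s) (omega p 0 ^ u.val) 0))
          atTop
          (𝓝 (volkenbornIntegral
            (hurwitzIntegrand (1 - algebraMap ℚ_[p] ℂ_[p] s) (omega p 0 ^ u.val) 0))) ∧
        Summable (interpolationTerm (omega p 0 ^ u.val) (algebraMap ℚ_[p] ℂ_[p] s))) ∧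
      -- for `s = 0` the limits defining the two functions at `1` exist
      (s = 0 →
        ContinuousAt (fun z : ℂ_[p] ↦ hurwitzZeta z (omega p 0 ^ u.val) 0) 1 ∧
        ContinuousAt (fun z : ℂ_[p] ↦ padicL z (omega p 0 ^ u.val)) 1) := by
  have hs_le : ‖algebraMap ℚ_[p] ℂ_[p] s‖ ≤ 1 := norm_algebraMap_padicInt_le_one s
  obtain ⟨coeff_eq, tendsto_coeff⟩ := coeff_zero_padicEisenstein hp 0 hu hsu
  refine ⟨?_, coeff_eq, tendsto_coeff, fun _ ↦ ⟨fun a _ ↦ summable_anglePowTerm hp hs_le a, ?_,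
    summable_interpolationTerm _ hp hs_le⟩, fun hs ↦ ?_⟩
  · rw [constantTerm, coeff_eq, hurwitzZeta_eq_padicL _ hp (by rwa [sub_sub_cancel])]
  · exact tendsto_nhds_limUnder ⟨_, tendsto_volkenbornSum_hurwitzIntegrand _ hp hs_le⟩
  · have hω : omega p 0 ^ u.val ≠ 1 := omega_pow_val_ne_one 0 fun hu0 ↦ hsu ⟨hs, hu0⟩
    exact ⟨continuousAt_hurwitzZeta_one _ hp hω,
      continuousAt_padicL _ hp (by rw [sub_self, norm_zero]; exact zero_le_one) fun _ ↦ hω⟩
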